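/- **Theorem 2.1 (Almost sure convergence).** Let $N\ge 1$, let $\alpha,\beta\in[0,1)$ with $\alpha+\beta\in(0,1)$, let $q\in(0,1]$, and let $f:[0,1]\to[0,1]$ be strictly increasing and of class $\mathcal C^1$ on $[0,1]$. Define $$F_h(\mathbf z)=\alpha\,\frac1N\sum_{i=1}^N z_i+\beta q+(1-\alpha-\beta)f(z_h)-z_h,\qquad \mathbf z\in[0,1]^N,\ h=1,\dots,N,$$ and $\mathcal Z(\mathbf F)=\{\mathbf z\in[0,1]^N:\mathbf F(\mathbf z)=\mathbf 0\}$. Let $(r_n)_{n\ge0}$ be real numbers with $\lim_{n\to\infty} n r_n=1$. On a probability space, let $\mathbf Z_n=(Z_{n,1},\dots,Z_{n,N})$, $n\ge0$, take values in $[0,1]^N$ and let $\mathbf I_n=(I_{n,1},\dots,I_{n,N})$, $n\ge1$, take values in $\{0,1\}^N$, where $\mathbf Z_0$ and all $\mathbf I_n$ are random vectors. Put $\mathcal F_n=\sigma(Z_{0,h},\,I_{k,h}:1\le k\le n,\ 1\le h\le N)$. Suppose that for all $n\ge0$ and all $h$ $$Z_{n+1,h}=(1-r_n)Z_{n,h}+r_nI_{n+1,h},$$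 $$P(I_{n+1,h}=1\mid\mathcal F_n)=\alpha\,\frac1N\sum_{i=1}^NZ_{n,i}+\beta q+(1-\alpha-\beta)f(Z_{n,h})\quad\text{a.s.},$$ and that $I_{n+1,1},\dots,I_{n+1,N}$ are conditionally independent given $\mathcal F_n$. Then the set $\mathcal Z(\mathbf F)$ contains at least one point of the form $z\mathbf 1=(z,\dots,z)$ with $z\in[0,1]$. If moreover $\mathcal Z(\mathbf F)$ is finite and $f$ admits a primitive function on $[0,1]$, then there is a random vector $\mathbf Z_\infty$ with values in $\mathcal Z(\mathbf F)$ such that $$\mathbf Z_n\xrightarrow{\ \text{a.s.}\ }\mathbf Z_\infty\qquad\text{and}\qquad \frac1n\sum_{k=1}^n\mathbf I_k\xrightarrow{\ \text{a.s.}\ }\mathbf Z_\infty .$$ -/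

import Mathlib

open MeasureTheory ProbabilityTheory Filter Topology

noncomputable section

namespace ReinforcedSystem

/-- The drift field
`F_h(z) = α * (1/N) * ∑ i, z_i + β * q + (1 - α - β) * f(z_h) - z_h`. -/
def drift (N : ℕ) (α β q : ℝ) (f : ℝ → ℝ) (z : Fin N → ℝ) : Fin N → ℝ :=
  fun h => α * ((1 / (N : ℝ)) * ∑ i, z i) + β * q + (1 - α - β) * f (z h) - z h

/-- The zero set of the drift field in the cube `[0,1]^N`. -/
def zeroSet (N : ℕ) (α β q : ℝ) (f : ℝ → ℝ) : Set (Fin N → ℝ) :=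
  {z | (∀ h, z h ∈ Set.Icc (0 : ℝ) 1) ∧ drift N α β q f z = 0}

/-- `f` has a primitive on `[0,1]` (with one-sided derivatives at the end points). -/
def HasPrimitive (f : ℝ → ℝ) : Prop :=
  ∃ φ : ℝ → ℝ, ∀ x ∈ Set.Icc (0 : ℝ) 1, HasDerivWithinAt φ (f x) (Set.Icc 0 1) x

/-- Conditional independence, given a σ-field `m`, of a finite family of real random variables:
the conditional probability of `{X_h ∈ A_h for all h ∈ S}` is the product of the conditional
probabilities of the events `{X_h ∈ A_h}`. -/
def CondIndepGiven {Ω : Type*} [MeasurableSpace Ω] (P : Measure Ω) (m : MeasurableSpace Ω)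
    {N : ℕ} (X : Fin N → Ω → ℝ) : Prop :=
  ∀ (S : Finset (Fin N)) (A : Fin N → Set ℝ), (∀ h ∈ S, MeasurableSet (A h)) →
    P⟦⋂ h ∈ S, X h ⁻¹' A h | m⟧ =ᵐ[P] ∏ h ∈ S, P⟦X h ⁻¹' A h | m⟧

/-- The past information at time `n`:
the σ-field generated by all `Z_{0,h}` and all `I_{k,h}` with `1 ≤ k ≤ n`. -/
@[reducible] def past {Ω : Type*} {N : ℕ} (Z I : ℕ → Ω → Fin N → ℝ) (n : ℕ) : MeasurableSpace Ω :=
  (⨆ h : Fin N, MeasurableSpace.comap (fun ω => Z 0 ω h) (borel ℝ)) ⊔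
    ⨆ k ∈ Finset.Icc 1 n, ⨆ h : Fin N, MeasurableSpace.comap (fun ω => I k ω h) (borel ℝ)

/-- The system of `N` interacting reinforced processes: `Z n ω h` is the inclination `Z_{n,h}`
and `I n ω h`, for `n ≥ 1`, is the action `I_{n,h}` (the value `I 0` is not used). -/
structure IsSystem {Ω : Type*} [MeasurableSpace Ω] (P : Measure Ω) (N : ℕ)
    (α β q : ℝ) (f : ℝ → ℝ) (r : ℕ → ℝ) (Z I : ℕ → Ω → Fin N → ℝ) : Prop where
  /-- The starting points are random variables. -/
  measurable_start : ∀ h, Measurable fun ω => Z 0 ω h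
  /-- The actions are random variables. -/
  measurable_action : ∀ n h, Measurable fun ω => I (n + 1) ω h
  /-- The inclinations lie in `[0,1]`; for `n ≥ 1` this is automatic from the case `n = 0` and
  the dynamics if all steps `r n` lie in `[0,1]`. -/
  state_mem : ∀ n ω h, Z n ω h ∈ Set.Icc (0 : ℝ) 1
  /-- The actions are `0` or `1`. -/
  action_mem : ∀ n ω h, I (n + 1) ω h = 0 ∨ I (n + 1) ω h = 1
  /-- `Z_{n+1,h} = (1 - r_n) Z_{n,h} + r_n I_{n+1,h}`. -/
  dynamics : ∀ n ω h, Z (n + 1) ω h = (1 - r n) * Z n ω h + r n * I (n + 1) ω h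
  /-- The conditional law of each action given the past. -/
  cond_prob : ∀ n h, P⟦{ω | I (n + 1) ω h = 1} | past Z I n⟧ =ᵐ[P]
    fun ω => α * ((1 / (N : ℝ)) * ∑ i, Z n ω i) + β * q + (1 - α - β) * f (Z n ω h)
  /-- The actions at time `n + 1` are conditionally independent given the past. -/
  cond_indep : ∀ n, CondIndepGiven P (past Z I n) fun h ω => I (n + 1) ω h

/-- The vector of empirical means `(1/n) ∑_{k=1}^n I_k`. -/
def empiricalMean {Ω : Type*} {N : ℕ} (I : ℕ → Ω → Fin N → ℝ) (n : ℕ) (ω : Ω) : Fin N → ℝ :=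
  (1 / (n : ℝ)) • ∑ k ∈ Finset.Icc 1 n, I k ω

end ReinforcedSystem

end

/-!
The drift `F` is the gradient of a potential `V` on the cube. Along the process, `V (Z n)` increases
in each step by at least `r n * ‖F (Z n)‖ ^ 2`, up to a martingale difference and a term of order
`r n ^ 2`, both with convergent sums. As `V` is bounded, the series `∑ r n * ‖F (Z n)‖ ^ 2`
converges. Since `F` is Lipschitz and the noise series converges, `F (Z n)` cannot make infinitely
many excursions from small to large values, hence it tends to `0`. All cluster points of `Z n` are
therefore zeros of `F`, and as the steps vanish and the zeros are finitely many, `Z n` converges.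
The actions are `Z n + F (Z n)` plus noise, so that their empirical means have the same limit by
Cesàro's and Kronecker's lemmas.
-/

namespace ReinforcedSystem

section MartingaleDifference

variable {Ω : Type*} {mΩ : MeasurableSpace Ω} {P : Measure Ω} {ℱ : Filtration ℕ mΩ}
  {ξ c : ℕ → Ω → ℝ} {b : ℕ → ℝ}

/-- A sequence of martingale differences, indexed so that `ξ n` is the increment from time `n` to
time `n + 1`. -/
structure IsMartingaleDifference (P : Measure Ω) (ℱ : Filtration ℕ mΩ) (ξ : ℕ → Ω → ℝ) :
    Prop where
  stronglyMeasurable : ∀ n, StronglyMeasurable[ℱ (n + 1)] (ξ n)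
  integrable : ∀ n, Integrable (ξ n) P
  condExp_eq_zero : ∀ n, P[ξ n | ℱ n] =ᵐ[P] 0

namespace IsMartingaleDifference

lemma stronglyMeasurable_sum_range (hξ : IsMartingaleDifference P ℱ ξ) (n : ℕ) :
    StronglyMeasurable[ℱ n] fun ω => ∑ k ∈ Finset.range n, ξ k ω :=
  Finset.stronglyMeasurable_fun_sum _ fun k hk =>
    (hξ.stronglyMeasurable k).mono (ℱ.mono (Finset.mem_range.1 hk))

lemma condExp_mul_eq_zero (hξ : IsMartingaleDifference P ℱ ξ) {n : ℕ} {g : Ω → ℝ}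
    (hg : StronglyMeasurable[ℱ n] g) (hgξ : Integrable (g * ξ n) P) :
    P[g * ξ n | ℱ n] =ᵐ[P] 0 := by
  filter_upwards [condExp_mul_of_stronglyMeasurable_left hg hgξ (hξ.integrable n),
    hξ.condExp_eq_zero n] with ω hpull hzero
  rw [hpull, Pi.mul_apply, hzero, Pi.zero_apply, mul_zero]

lemma mul_predictable (hξ : IsMartingaleDifference P ℱ ξ)
    (hc : ∀ n, StronglyMeasurable[ℱ n] (c n)) (hcb : ∀ n ω, |c n ω| ≤ b n) :
    IsMartingaleDifference P ℱ fun n => c n * ξ n := by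
  have hint : ∀ n, Integrable (c n * ξ n) P := fun n =>
    (hξ.integrable n).bdd_mul ((hc n).mono (ℱ.le n)).aestronglyMeasurable
      (Eventually.of_forall (hcb n))
  exact ⟨fun n => ((hc n).mono (ℱ.mono n.le_succ)).mul (hξ.stronglyMeasurable n), hint,
    fun n => hξ.condExp_mul_eq_zero (hc n) (hint n)⟩

variable [IsFiniteMeasure P]

lemma martingale_sum_range (hξ : IsMartingaleDifference P ℱ ξ) :
    Martingale (fun n ω => ∑ k ∈ Finset.range n, ξ k ω) ℱ P := by
  have hint : ∀ n, Integrable (fun ω => ∑ k ∈ Finset.range n, ξ k ω) P := fun n =>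
    integrable_finsetSum _ fun k _ => hξ.integrable k
  refine martingale_of_condExp_sub_eq_zero_nat hξ.stronglyMeasurable_sum_range hint fun n => ?_
  convert hξ.condExp_eq_zero n using 2
  ext ω
  simp [Finset.sum_range_succ]

/-- Martingale differences are orthogonal in `L²`. -/
lemma integral_sq_sum_range (hξ : IsMartingaleDifference P ℱ ξ) (hL2 : ∀ n, MemLp (ξ n) 2 P)
    (n : ℕ) :
    ∫ ω, (∑ k ∈ Finset.range n, ξ k ω) ^ 2 ∂P = ∑ k ∈ Finset.range n, ∫ ω, ξ k ω ^ 2 ∂P := by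
  induction n with
  | zero => simp
  | succ n ih =>
    set S : Ω → ℝ := fun ω => ∑ k ∈ Finset.range n, ξ k ω
    have hS : MemLp S 2 P := memLp_finsetSum _ fun k _ => hL2 k
    have hSξ : Integrable (S * ξ n) P := hS.integrable_mul (hL2 n)
    have horth : ∫ ω, (S * ξ n) ω ∂P = 0 := by
      rw [← integral_condExp (ℱ.le n)]
      exact integral_eq_zero_of_ae
        (hξ.condExp_mul_eq_zero (hξ.stronglyMeasurable_sum_range n) hSξ)
    have hcross : Integrable (fun ω => S ω ^ 2 + 2 * (S * ξ n) ω) P :=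
      hS.integrable_sq.add (hSξ.const_mul 2)
    calc ∫ ω, (∑ k ∈ Finset.range (n + 1), ξ k ω) ^ 2 ∂P
        = ∫ ω, S ω ^ 2 + 2 * (S * ξ n) ω + ξ n ω ^ 2 ∂P := by
          refine integral_congr_ae (Eventually.of_forall fun ω => ?_)
          simp only [Finset.sum_range_succ, S, Pi.mul_apply]
          ring
      _ = ∫ ω, S ω ^ 2 ∂P + ∫ ω, ξ n ω ^ 2 ∂P := by
          rw [integral_add hcross (hL2 n).integrable_sq,
            integral_add hS.integrable_sq (hSξ.const_mul 2), integral_const_mul, horth, mul_zero,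
            add_zero]
      _ = ∑ k ∈ Finset.range (n + 1), ∫ ω, ξ k ω ^ 2 ∂P := by
          rw [ih, Finset.sum_range_succ]

lemma ae_exists_tendsto_sum_range (hξ : IsMartingaleDifference P ℱ ξ)
    (hL2 : ∀ n, MemLp (ξ n) 2 P) (hs : Summable fun n => ∫ ω, ξ n ω ^ 2 ∂P) :
    ∀ᵐ ω ∂P, ∃ l, Tendsto (fun n => ∑ k ∈ Finset.range n, ξ k ω) atTop (𝓝 l) := by
  have hM := hξ.martingale_sum_range
  refine hM.submartingale.exists_ae_tendsto_of_bdd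
    (R := (P.real Set.univ + ∑' k, ∫ ω, ξ k ω ^ 2 ∂P).toNNReal) fun n => ?_
  rw [eLpNorm_one_eq_lintegral_enorm, ← ofReal_integral_norm_eq_lintegral_enorm (hM.integrable n)]
  refine ENNReal.ofReal_le_ofReal ?_
  have hsq : Integrable (fun ω => (∑ k ∈ Finset.range n, ξ k ω) ^ 2) P :=
    (memLp_finsetSum _ fun k _ => hL2 k).integrable_sq
  calc ∫ ω, ‖∑ k ∈ Finset.range n, ξ k ω‖ ∂P
      ≤ ∫ ω, (1 + (∑ k ∈ Finset.range n, ξ k ω) ^ 2) ∂P := by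
        refine integral_mono (hM.integrable n).norm ((integrable_const 1).add hsq) fun ω => ?_
        have := sq_nonneg (‖∑ k ∈ Finset.range n, ξ k ω‖ - 1)
        have := norm_nonneg (∑ k ∈ Finset.range n, ξ k ω)
        dsimp only
        rw [← sq_abs (∑ k ∈ Finset.range n, ξ k ω), ← Real.norm_eq_abs]
        linarith
    _ = P.real Set.univ + ∑ k ∈ Finset.range n, ∫ ω, ξ k ω ^ 2 ∂P := by
        rw [integral_add (integrable_const 1) hsq, hξ.integral_sq_sum_range hL2]
        simp
    _ ≤ P.real Set.univ + ∑' k, ∫ ω, ξ k ω ^ 2 ∂P := by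
        gcongr
        exact hs.sum_le_tsum _ fun k _ => integral_nonneg fun ω => sq_nonneg _

lemma ae_exists_tendsto_sum_range_mul (hξ : IsMartingaleDifference P ℱ ξ) {B : ℝ}
    (hξB : ∀ n ω, |ξ n ω| ≤ B) (hc : ∀ n, StronglyMeasurable[ℱ n] (c n))
    (hcb : ∀ n ω, |c n ω| ≤ b n) (hb : Summable fun n => b n ^ 2) :
    ∀ᵐ ω ∂P, ∃ l, Tendsto (fun n => ∑ k ∈ Finset.range n, c k ω * ξ k ω) atTop (𝓝 l) := by
  have hcξ := hξ.mul_predictable hc hcb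
  have hbound : ∀ n ω, ‖(c n * ξ n) ω‖ ≤ b n * B := fun n ω => by
    rw [Pi.mul_apply, norm_mul]
    exact mul_le_mul (hcb n ω) (hξB n ω) (norm_nonneg _) ((abs_nonneg _).trans (hcb n ω))
  have hL2 : ∀ n, MemLp (c n * ξ n) 2 P := fun n =>
    MemLp.of_bound (hcξ.integrable n).aestronglyMeasurable _ (Eventually.of_forall (hbound n))
  refine hcξ.ae_exists_tendsto_sum_range hL2 ?_
  refine Summable.of_nonneg_of_le (fun n => integral_nonneg fun ω => sq_nonneg _) (fun n => ?_)
    (hb.mul_left (P.real Set.univ * B ^ 2))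
  calc ∫ ω, (c n * ξ n) ω ^ 2 ∂P
      ≤ ∫ _, (b n * B) ^ 2 ∂P := by
        refine integral_mono (hL2 n).integrable_sq (integrable_const _) fun ω => ?_
        simpa only [norm_pow, Real.norm_eq_abs, sq_abs]
          using pow_le_pow_left₀ (norm_nonneg _) (hbound n ω) 2
    _ = P.real Set.univ * B ^ 2 * b n ^ 2 := by
        rw [integral_const, smul_eq_mul]
        ring

end IsMartingaleDifference

end MartingaleDifference

section Sequences

variable {E : Type*} [NormedAddCommGroup E] [NormedSpace ℝ E]

/-- Kronecker's lemma for the weights `1 / (n + 1)`. -/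
lemma tendsto_average_zero_of_tendsto_sum_inv_smul {x : ℕ → E} {l : E}
    (h : Tendsto (fun n => ∑ k ∈ Finset.range n, ((k : ℝ) + 1)⁻¹ • x k) atTop (𝓝 l)) :
    Tendsto (fun n : ℕ => (n : ℝ)⁻¹ • ∑ k ∈ Finset.range n, x k) atTop (𝓝 0) := by
  set S : ℕ → E := fun n => ∑ k ∈ Finset.range n, ((k : ℝ) + 1)⁻¹ • x k
  have S_succ : ∀ n, S (n + 1) = S n + ((n : ℝ) + 1)⁻¹ • x n := fun n =>
    Finset.sum_range_succ _ n
  have sum_by_parts : ∀ n : ℕ,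
      ∑ k ∈ Finset.range n, x k = (n : ℝ) • S n - ∑ k ∈ Finset.range n, S k := by
    intro n
    induction n with
    | zero => simp
    | succ n ih =>
      have hn : (n : ℝ) + 1 ≠ 0 := by positivity
      rw [Finset.sum_range_succ, Finset.sum_range_succ, ih, S_succ, Nat.cast_add_one, smul_add,
        smul_inv_smul₀ hn, add_smul, one_smul]
      abel
  have hlim := h.sub h.cesaro_smul
  rw [sub_self] at hlim
  refine hlim.congr' ?_
  filter_upwards [eventually_ne_atTop 0] with n hn
  rw [sum_by_parts, smul_sub, inv_smul_smul₀ (Nat.cast_ne_zero.2 hn)]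

lemma exists_last_le {p : ℕ → Prop} {m n : ℕ} (hm : p m) (hmn : m ≤ n) :
    ∃ j, m ≤ j ∧ j ≤ n ∧ p j ∧ ∀ k, j < k → k ≤ n → ¬ p k := by
  classical
  exact ⟨Nat.findGreatest p n, Nat.le_findGreatest hmn hm, Nat.findGreatest_le n,
    Nat.findGreatest_spec hmn hm, fun _ => Nat.findGreatest_is_greatest⟩

lemma exists_forall_sum_Ico_lt_of_summable {u : ℕ → ℝ} (hu : Summable u) {ε : ℝ} (hε : 0 < ε) :
    ∃ n₀, ∀ m n, n₀ ≤ m → m ≤ n → ∑ k ∈ Finset.Ico m n, u k < ε := by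
  obtain ⟨n₀, hn₀⟩ := Metric.cauchySeq_iff.1 hu.hasSum.tendsto_sum_nat.cauchySeq ε hε
  refine ⟨n₀, fun m n hm hmn => ?_⟩
  rw [Finset.sum_Ico_eq_sub _ hmn]
  exact (le_abs_self _).trans_lt (hn₀ n (hm.trans hmn) m hm)

lemma summable_of_sum_range_bddAbove {u : ℕ → ℝ} (hu : ∀ᶠ n in atTop, 0 ≤ u n)
    (hb : BddAbove (Set.range fun n => ∑ k ∈ Finset.range n, u k)) : Summable u := by
  obtain ⟨m, hm⟩ := eventually_atTop.1 hu
  obtain ⟨R, hR⟩ := hb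
  rw [← summable_nat_add_iff m]
  refine summable_of_sum_range_le (c := R - ∑ k ∈ Finset.range m, u k)
    (fun n => hm _ (Nat.le_add_left m n)) fun n => ?_
  have hmn : ∑ k ∈ Finset.range (m + n), u k ≤ R := hR (Set.mem_range_self (m + n))
  rw [Finset.sum_range_add] at hmn
  simp_rw [add_comm _ m]
  linarith

lemma summable_of_add_le_sub {u e V : ℕ → ℝ} {l : ℝ} (hu : ∀ᶠ n in atTop, 0 ≤ u n)
    (hV : BddAbove (Set.range V)) (huV : ∀ n, u n + e n ≤ V (n + 1) - V n)
    (he : Tendsto (fun n => ∑ k ∈ Finset.range n, e k) atTop (𝓝 l)) : Summable u := by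
  obtain ⟨B, hB⟩ := hV
  obtain ⟨R, hR⟩ := he.bddBelow_range
  refine summable_of_sum_range_bddAbove hu ⟨B - V 0 - R, ?_⟩
  rintro _ ⟨n, rfl⟩
  have htele := Finset.sum_le_sum fun k (_ : k ∈ Finset.range n) => huV k
  rw [Finset.sum_range_sub, Finset.sum_add_distrib] at htele
  linarith [hB (Set.mem_range_self n), hR (Set.mem_range_self n)]

end Sequences

section RobbinsMonro

lemma mul_sum_mul_le_sum_mul_sq {ι : Type*} {s : Finset ι} {r a : ι → ℝ} {ε : ℝ}
    (hr : ∀ k ∈ s, 0 ≤ r k) (ha : ∀ k ∈ s, 0 ≤ a k) (hεa : ∀ k ∈ s, ε ≤ a k) :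
    ε * ∑ k ∈ s, r k * a k ≤ ∑ k ∈ s, r k * a k ^ 2 := by
  rw [Finset.mul_sum]
  refine Finset.sum_le_sum fun k hk => ?_
  have := mul_le_mul_of_nonneg_right (hεa k hk) (mul_nonneg (hr k hk) (ha k hk))
  linarith

/-- The Robbins–Monro conditions on the step sizes of a stochastic approximation scheme. -/
structure IsRobbinsMonro (r : ℕ → ℝ) : Prop where
  eventually_nonneg : ∀ᶠ n in atTop, 0 ≤ r n
  not_summable : ¬ Summable r
  summable_sq : Summable fun n => r n ^ 2

namespace IsRobbinsMonro

variable {r : ℕ → ℝ}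

lemma of_tendsto_mul {c : ℝ} (hc : 0 < c)
    (hr : Tendsto (fun n : ℕ => (n : ℝ) * r n) atTop (𝓝 c)) : IsRobbinsMonro r := by
  have hequiv : Asymptotics.IsEquivalent atTop r fun n => c * (1 / (n : ℝ)) := by
    refine Asymptotics.isEquivalent_of_tendsto_one ?_
    have hlim := hr.div_const c
    rw [div_self hc.ne'] at hlim
    refine hlim.congr fun n => ?_
    rw [Pi.div_apply, mul_one_div, div_div_eq_mul_div, mul_comm]
  refine ⟨?_, fun hsum => ?_, ?_⟩
  · filter_upwards [hr.eventually (lt_mem_nhds hc)] with n hn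
    exact (pos_of_mul_pos_right hn n.cast_nonneg).le
  · exact Real.not_summable_one_div_natCast
      ((summable_mul_left_iff hc.ne').1 (hequiv.summable_iff_nat.1 hsum))
  · have hsq : Summable fun n : ℕ => (c * (1 / (n : ℝ))) ^ 2 := by
      simpa only [mul_pow, one_div_pow]
        using (Real.summable_one_div_nat_pow.2 one_lt_two).mul_left (c ^ 2)
    exact (hequiv.pow 2).summable_iff_nat.2 hsq

lemma tendsto_zero (hr : IsRobbinsMonro r) : Tendsto r atTop (𝓝 0) := by
  simpa [Real.sqrt_sq_eq_abs, tendsto_zero_iff_abs_tendsto_zero, Function.comp_def]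
    using hr.summable_sq.tendsto_atTop_zero.sqrt

lemma frequently_lt_of_summable_mul_sq (hr : IsRobbinsMonro r) {a : ℕ → ℝ}
    (hs : Summable fun n => r n * a n ^ 2) {ε : ℝ} (hε : 0 < ε) : ∃ᶠ n in atTop, a n < ε := by
  intro hge
  refine hr.not_summable ?_
  refine Summable.of_norm_bounded_eventually_nat (hs.mul_left (ε ^ 2)⁻¹) ?_
  filter_upwards [hge, hr.eventually_nonneg] with n han hrn
  rw [Real.norm_of_nonneg hrn, inv_mul_eq_div, le_div_iff₀ (by positivity)]
  exact mul_le_mul_of_nonneg_left (pow_le_pow_left₀ hε.le (not_lt.1 han) 2) hrn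

/-- `a` is often below `ε`, and after the last such time `j` before `n` the increment of `a` is
controlled, since `r a ≤ ε⁻¹ r a ^ 2` as long as `a ≥ ε`. -/
lemma tendsto_zero_of_summable_mul_sq (hr : IsRobbinsMonro r) {a : ℕ → ℝ} (ha : ∀ n, 0 ≤ a n)
    (hs : Summable fun n => r n * a n ^ 2) {L : ℝ} (hL : 0 ≤ L)
    (hinc : ∀ ε > 0, ∃ n₀, ∀ m n, n₀ ≤ m → m ≤ n →
      a n ≤ a m + L * ∑ k ∈ Finset.Ico m n, r k * a k + ε) :
    Tendsto a atTop (𝓝 0) := by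
  rw [Metric.tendsto_atTop]
  intro η hη
  set ε := η / (2 * L + 3) with hε_def
  have hε : 0 < ε := by positivity
  obtain ⟨n₁, hinc⟩ := hinc ε hε
  obtain ⟨n₂, htail⟩ := exists_forall_sum_Ico_lt_of_summable hs (show 0 < ε * ε by positivity)
  obtain ⟨n₃, hsteps⟩ := eventually_atTop.1
    (hr.eventually_nonneg.and (hr.tendsto_zero.eventually (gt_mem_nhds one_pos)))
  obtain ⟨m, hm, ham⟩ := frequently_atTop.1 (hr.frequently_lt_of_summable_mul_sq hs hε)
    (max n₁ (max n₂ n₃))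
  refine ⟨m, fun n hn => ?_⟩
  obtain ⟨j, hmj, hjn, haj, hlast⟩ := exists_last_le (p := fun k => a k < ε) ham hn
  have hlarge : ∀ k ∈ Finset.Ico (j + 1) n, ε ≤ a k := fun k hk =>
    not_lt.1 (hlast k (Finset.mem_Ico.1 hk).1 (Finset.mem_Ico.1 hk).2.le)
  have hexcursion : ∑ k ∈ Finset.Ico (j + 1) n, r k * a k ≤ ε := by
    rcases hjn.eq_or_lt with hjn | hjn
    · simp [hjn, hε.le]
    · exact le_of_mul_le_mul_left ((mul_sum_mul_le_sum_mul_sq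
        (fun k hk => (hsteps k (by grind)).1) (fun k _ => ha k) hlarge).trans
          (htail (j + 1) n (by omega) hjn).le) hε
  have hsum : ∑ k ∈ Finset.Ico j n, r k * a k ≤ 2 * ε := by
    rcases hjn.eq_or_lt with hjn | hjn
    · simp [hjn, hε.le]
    · rw [Finset.sum_eq_sum_Ico_succ_bot hjn]
      have := mul_le_of_le_one_left (ha j) (hsteps j (by omega)).2.le
      linarith
  rw [Real.dist_0_eq_abs, abs_of_nonneg (ha n)]
  calc a n ≤ a j + L * ∑ k ∈ Finset.Ico j n, r k * a k + ε := hinc j n (by omega) hjn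
    _ ≤ a j + L * (2 * ε) + ε := by gcongr
    _ < ε + L * (2 * ε) + 2 * ε := by linarith
    _ = η := by rw [hε_def]; field_simp; ring

end IsRobbinsMonro

end RobbinsMonro

section ClusterPoints

/-- The steps eventually become too small for the sequence to jump between different cluster
points. -/
lemma exists_tendsto_of_finite_mapClusterPt {X : Type*} [MetricSpace X] {K : Set X}
    (hK : IsCompact K) {z : ℕ → X} (hz : ∀ n, z n ∈ K)
    (hstep : Tendsto (fun n => dist (z n) (z (n + 1))) atTop (𝓝 0))
    (hfin : {x | MapClusterPt x atTop z}.Finite) : ∃ x, Tendsto z atTop (𝓝 x) := by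
  obtain ⟨δ, hδ, hsep⟩ : ∃ δ > 0, ∀ x, MapClusterPt x atTop z → ∀ y, MapClusterPt y atTop z →
      x ≠ y → δ ≤ dist x y := by
    obtain ⟨C, hC, hsep⟩ := hfin.relatively_discrete
    obtain ⟨δ, hδ, hδC⟩ := ENNReal.lt_iff_exists_nnreal_btwn.1 hC
    refine ⟨δ, ENNReal.coe_pos.1 hδ, fun x hx y hy hxy => ?_⟩
    have := hδC.le.trans (hsep x hx y hy hxy)
    rwa [edist_nndist, ENNReal.coe_le_coe] at this
  have near : ∀ᶠ n in atTop, z n ∈ ⋃ x ∈ {x | MapClusterPt x atTop z}, Metric.ball x (δ / 3) :=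
    hK.adherence_nhdset (tendsto_principal.2 (Eventually.of_forall hz))
      (isOpen_biUnion fun _ _ => Metric.isOpen_ball)
      fun x _ hx => Set.mem_biUnion hx (Metric.mem_ball_self (by positivity))
  obtain ⟨n₀, hn₀⟩ := eventually_atTop.1
    (near.and (hstep.eventually (gt_mem_nhds (show 0 < δ / 3 by positivity))))
  obtain ⟨x, hx, hx₀⟩ := Set.mem_iUnion₂.1 (hn₀ n₀ le_rfl).1
  have stay : ∀ n, n₀ ≤ n → z n ∈ Metric.ball x (δ / 3) := by
    intro n hn
    induction n, hn using Nat.le_induction with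
    | base => exact hx₀
    | succ n hn ih =>
      obtain ⟨y, hy, hny⟩ := Set.mem_iUnion₂.1 (hn₀ (n + 1) (by omega)).1
      suffices x = y by rwa [this]
      by_contra hne
      have hxy := dist_triangle4 x (z n) (z (n + 1)) y
      rw [dist_comm x (z n)] at hxy
      linarith [hsep x hx y hy hne, (hn₀ n hn).2, Metric.mem_ball.1 ih, Metric.mem_ball.1 hny]
  refine ⟨x, hK.tendsto_nhds_of_unique_mapClusterPt (Eventually.of_forall hz) fun y _ hy => ?_⟩
  by_contra hne
  obtain ⟨n, hny, hn⟩ := ((hy.frequently (Metric.ball_mem_nhds y (show 0 < δ / 3 by positivity))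
    ).and_eventually (eventually_ge_atTop n₀)).exists
  have hyx := dist_triangle_left y x (z n)
  linarith [hsep y hy x hx hne, Metric.mem_ball.1 hny, Metric.mem_ball.1 (stay n hn)]

lemma mem_and_eq_of_mapClusterPt {X Y : Type*} [TopologicalSpace X] [TopologicalSpace Y]
    [T2Space Y] {K : Set X} (hK : IsClosed K) {F : X → Y} (hF : ContinuousOn F K) {z : ℕ → X}
    (hz : ∀ n, z n ∈ K) {x : X} (hx : MapClusterPt x atTop z) {y : Y}
    (hlim : Tendsto (fun n => F (z n)) atTop (𝓝 y)) : x ∈ K ∧ F x = y := by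
  have hxK : x ∈ K := hK.mem_of_mapClusterPt hx (Eventually.of_forall hz)
  have hFx : MapClusterPt (F x) atTop (F ∘ z) := by
    refine hx.tendsto_comp' ((hF x hxK).mono_left (inf_le_inf_left _ ?_))
    exact tendsto_principal.2 (Eventually.of_forall hz)
  refine ⟨hxK, eq_of_nhds_neBot (hFx.neBot.mono (inf_le_inf_left _ hlim))⟩

lemma exists_tendsto_mem_and_eq {X Y : Type*} [MetricSpace X] [TopologicalSpace Y] [T2Space Y]
    {K : Set X} (hK : IsCompact K) {F : X → Y} (hF : ContinuousOn F K) {y : Y}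
    (hfin : {x ∈ K | F x = y}.Finite) {z : ℕ → X} (hz : ∀ n, z n ∈ K)
    (hstep : Tendsto (fun n => dist (z n) (z (n + 1))) atTop (𝓝 0))
    (hlim : Tendsto (fun n => F (z n)) atTop (𝓝 y)) :
    ∃ x ∈ K, F x = y ∧ Tendsto z atTop (𝓝 x) := by
  have hfiber : ∀ x, MapClusterPt x atTop z → x ∈ K ∧ F x = y := fun x hx =>
    mem_and_eq_of_mapClusterPt hK.isClosed hF hz hx hlim
  obtain ⟨x, hx⟩ := exists_tendsto_of_finite_mapClusterPt hK hz hstep (hfin.subset hfiber)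
  exact ⟨x, (hfiber x hx.mapClusterPt).1, (hfiber x hx.mapClusterPt).2, hx⟩

end ClusterPoints

section EulerScheme

open scoped NNReal

variable {E : Type*} [NormedAddCommGroup E] [NormedSpace ℝ E] {K : Set E} {F : E → E}
  {r : ℕ → ℝ} {z D : ℕ → E}

lemma sub_eq_sum_Ico_add_sum_Ico (hz : ∀ n, z (n + 1) = z n + r n • (F (z n) + D n)) {m n : ℕ}
    (hmn : m ≤ n) :
    z n - z m = ∑ k ∈ Finset.Ico m n, r k • F (z k) + ∑ k ∈ Finset.Ico m n, r k • D k := by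
  rw [← Finset.sum_Ico_sub z hmn, ← Finset.sum_add_distrib]
  refine Finset.sum_congr rfl fun k _ => ?_
  rw [hz, add_sub_cancel_left, smul_add]

lemma tendsto_field_zero_of_summable {L : ℝ≥0} (hr : IsRobbinsMonro r)
    (hF : LipschitzOnWith L F K) (hzK : ∀ n, z n ∈ K)
    (hz : ∀ n, z (n + 1) = z n + r n • (F (z n) + D n)) {l : E}
    (hD : Tendsto (fun n => ∑ k ∈ Finset.range n, r k • D k) atTop (𝓝 l))
    (hs : Summable fun n => r n * ‖F (z n)‖ ^ 2) : Tendsto (fun n => F (z n)) atTop (𝓝 0) := by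
  rw [tendsto_zero_iff_norm_tendsto_zero]
  refine hr.tendsto_zero_of_summable_mul_sq (fun n => norm_nonneg _) hs L.coe_nonneg
    fun ε hε => ?_
  obtain ⟨n₁, hn₁⟩ := Metric.cauchySeq_iff.1 hD.cauchySeq (ε / (L + 1)) (by positivity)
  obtain ⟨n₂, hn₂⟩ := eventually_atTop.1 hr.eventually_nonneg
  refine ⟨max n₁ n₂, fun m n hm hmn => ?_⟩
  have hnoise : ‖∑ k ∈ Finset.Ico m n, r k • D k‖ ≤ ε / (L + 1) := by
    rw [Finset.sum_Ico_eq_sub _ hmn, ← dist_eq_norm]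
    exact (hn₁ n (by omega) m (by omega)).le
  have hfield : ‖∑ k ∈ Finset.Ico m n, r k • F (z k)‖
      ≤ ∑ k ∈ Finset.Ico m n, r k * ‖F (z k)‖ := by
    refine norm_sum_le_of_le _ fun k hk => ?_
    rw [norm_smul, Real.norm_of_nonneg (hn₂ k (by grind))]
  calc ‖F (z n)‖ ≤ ‖F (z m)‖ + ‖F (z n) - F (z m)‖ := norm_le_norm_add_norm_sub' _ _
    _ ≤ ‖F (z m)‖ + L * ‖z n - z m‖ := by
      gcongr
      exact hF.norm_sub_le (hzK n) (hzK m)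
    _ ≤ ‖F (z m)‖ + L * (∑ k ∈ Finset.Ico m n, r k * ‖F (z k)‖ + ε / (L + 1)) := by
      rw [sub_eq_sum_Ico_add_sum_Ico hz hmn]
      gcongr
      exact norm_add_le_of_le hfield hnoise
    _ ≤ ‖F (z m)‖ + L * ∑ k ∈ Finset.Ico m n, r k * ‖F (z k)‖ + ε := by
      rw [mul_add, ← add_assoc]
      gcongr
      rw [mul_div_left_comm]
      exact mul_le_of_le_one_right hε.le ((div_le_one (by positivity)).2 (by linarith))

end EulerScheme

section LowerGradient

open scoped NNReal

variable {ι : Type*} [Fintype ι] {K : Set (ι → ℝ)} {V : (ι → ℝ) → ℝ} {F : (ι → ℝ) → ι → ℝ}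
  {C : ℝ} {r : ℕ → ℝ} {z D : ℕ → ι → ℝ}

/-- On `K` the function `V` grows along `F` as if `F` were its gradient, up to a quadratic error
with constant `C`. Only the lower half of a Taylor estimate is asked for, so that `V` need not be
differentiable. -/
def IsLowerGradientOn (V : (ι → ℝ) → ℝ) (F : (ι → ℝ) → ι → ℝ) (C : ℝ) (K : Set (ι → ℝ)) : Prop :=
  ∀ z ∈ K, ∀ w ∈ K, F z ⬝ᵥ (w - z) - C * ‖w - z‖ ^ 2 ≤ V w - V z

lemma norm_sq_le_dotProduct_self (v : ι → ℝ) : ‖v‖ ^ 2 ≤ v ⬝ᵥ v := by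
  have hv : 0 ≤ v ⬝ᵥ v := dotProduct_self_star_nonneg v
  refine (Real.le_sqrt (norm_nonneg v) hv).1 ((pi_norm_le_iff_of_nonneg (Real.sqrt_nonneg _)).2
    fun i => Real.abs_le_sqrt ?_)
  rw [sq]
  exact Finset.single_le_sum (fun j _ => mul_self_nonneg (v j)) (Finset.mem_univ i)

namespace IsLowerGradientOn

lemma bddAbove_image (hV : IsLowerGradientOn V F C K) (hK : IsCompact K)
    (hF : ContinuousOn F K) : BddAbove (V '' K) := by
  rcases K.eq_empty_or_nonempty with rfl | ⟨w, hw⟩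
  · simp
  have hcont : ContinuousOn (fun z => V w - F z ⬝ᵥ (w - z) + C * ‖w - z‖ ^ 2) K := by
    unfold dotProduct
    fun_prop
  obtain ⟨R, hR⟩ := hK.bddAbove_image hcont
  refine ⟨R, Set.forall_mem_image.2 fun z hz => ?_⟩
  linarith [hV z hz w hw, hR (Set.mem_image_of_mem _ hz)]

lemma summable_mul_norm_sq (hV : IsLowerGradientOn V F C K) (hr : IsRobbinsMonro r)
    (hVK : BddAbove (V '' K)) (hzK : ∀ n, z n ∈ K)
    (hz : ∀ n, z (n + 1) = z n + r n • (F (z n) + D n)) {B : ℝ} (hB : ∀ n, ‖F (z n) + D n‖ ≤ B)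
    {l : ℝ} (hD : Tendsto (fun n => ∑ k ∈ Finset.range n, r k * (F (z k) ⬝ᵥ D k)) atTop (𝓝 l)) :
    Summable fun n => r n * ‖F (z n)‖ ^ 2 := by
  have hdiff : ∀ n, z (n + 1) - z n = r n • (F (z n) + D n) := fun n => by
    rw [hz, add_sub_cancel_left]
  have hstep : Summable fun n => ‖z (n + 1) - z n‖ ^ 2 := by
    refine Summable.of_nonneg_of_le (fun n => sq_nonneg _) (fun n => ?_)
      (hr.summable_sq.mul_right (B ^ 2))
    rw [hdiff, norm_smul, mul_pow, Real.norm_eq_abs, sq_abs]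
    gcongr
    exact hB n
  have herror : Tendsto (fun n => ∑ k ∈ Finset.range n,
      (r k * (F (z k) ⬝ᵥ D k) - C * ‖z (k + 1) - z k‖ ^ 2)) atTop
      (𝓝 (l - ∑' k, C * ‖z (k + 1) - z k‖ ^ 2)) := by
    simp only [Finset.sum_sub_distrib]
    exact hD.sub (hstep.mul_left C).hasSum.tendsto_sum_nat
  have hdot : Summable fun n => r n * (F (z n) ⬝ᵥ F (z n)) := by
    refine summable_of_add_le_sub (hr.eventually_nonneg.mono fun n hn =>
      mul_nonneg hn (dotProduct_self_star_nonneg _)) (V := V ∘ z) (hVK.mono ?_) (fun n => ?_) herror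
    · exact Set.range_subset_iff.2 fun n => Set.mem_image_of_mem V (hzK n)
    · have := hV _ (hzK n) _ (hzK (n + 1))
      rw [hdiff, dotProduct_smul, dotProduct_add, smul_eq_mul, ← hdiff] at this
      simp only [Function.comp_apply]
      linarith
  refine Summable.of_norm_bounded_eventually_nat hdot ?_
  filter_upwards [hr.eventually_nonneg] with n hn
  rw [Real.norm_of_nonneg (by positivity)]
  exact mul_le_mul_of_nonneg_left (norm_sq_le_dotProduct_self _) hn

theorem exists_tendsto_zero (hV : IsLowerGradientOn V F C K) (hr : IsRobbinsMonro r)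
    (hK : IsCompact K) {L : ℝ≥0} (hF : LipschitzOnWith L F K)
    (hfin : {x ∈ K | F x = 0}.Finite) (hzK : ∀ n, z n ∈ K)
    (hz : ∀ n, z (n + 1) = z n + r n • (F (z n) + D n)) {B : ℝ} (hB : ∀ n, ‖F (z n) + D n‖ ≤ B)
    {l : ι → ℝ} (hD : Tendsto (fun n => ∑ k ∈ Finset.range n, r k • D k) atTop (𝓝 l)) {l' : ℝ}
    (hFD : Tendsto (fun n => ∑ k ∈ Finset.range n, r k * (F (z k) ⬝ᵥ D k)) atTop (𝓝 l')) :
    ∃ x ∈ K, F x = 0 ∧ Tendsto z atTop (𝓝 x) := by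
  have hs := hV.summable_mul_norm_sq hr (hV.bddAbove_image hK hF.continuousOn) hzK hz hB hFD
  have hstep : Tendsto (fun n => dist (z n) (z (n + 1))) atTop (𝓝 0) := by
    refine squeeze_zero (fun n => dist_nonneg) (fun n => ?_)
      (by simpa only [norm_zero, zero_mul] using hr.tendsto_zero.norm.mul_const B)
    rw [hz, dist_self_add_right, norm_smul]
    exact mul_le_mul_of_nonneg_left (hB n) (norm_nonneg _)
  exact exists_tendsto_mem_and_eq hK hF.continuousOn hfin hzK hstep
    (tendsto_field_zero_of_summable hr hF hzK hz hD hs)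

end IsLowerGradientOn

end LowerGradient

section ReinforcedProcess

lemma exists_measurable_limit_mem {Ω X : Type*} [MeasurableSpace Ω] {P : Measure Ω} [NeZero P]
    [TopologicalSpace X] [TopologicalSpace.PseudoMetrizableSpace X] [T2Space X] [MeasurableSpace X]
    [BorelSpace X] {S : Set X} (hS : MeasurableSet S) {Z : ℕ → Ω → X}
    (hZ : ∀ n, AEMeasurable (Z n) P)
    (hlim : ∀ᵐ ω ∂P, ∃ x ∈ S, Tendsto (fun n => Z n ω) atTop (𝓝 x)) :
    ∃ Y : Ω → X, Measurable Y ∧ (∀ ω, Y ω ∈ S) ∧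
      ∀ᵐ ω ∂P, Tendsto (fun n => Z n ω) atTop (𝓝 (Y ω)) := by
  classical
  obtain ⟨_, x₀, hx₀, _⟩ := hlim.exists
  obtain ⟨Y, hY, hZY⟩ := measurable_limit_of_tendsto_metrizable_ae hZ
    (hlim.mono fun ω ⟨x, _, hx⟩ => ⟨x, hx⟩)
  refine ⟨(Y ⁻¹' S).piecewise Y fun _ => x₀, hY.piecewise (hY hS) measurable_const, fun ω => ?_, ?_⟩
  · by_cases hω : ω ∈ Y ⁻¹' S
    · rwa [Set.piecewise_eq_of_mem _ _ _ hω]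
    · rwa [Set.piecewise_eq_of_notMem _ _ _ hω]
  · filter_upwards [hlim, hZY] with ω ⟨x, hxS, hx⟩ hYω
    obtain rfl := tendsto_nhds_unique hx hYω
    have hω : ω ∈ Y ⁻¹' S := hxS
    rwa [Set.piecewise_eq_of_mem _ _ _ hω]

variable {Ω ι : Type*} {mΩ : MeasurableSpace Ω} {P : Measure Ω} {ℱ : Filtration ℕ mΩ}
  {F : (ι → ℝ) → ι → ℝ} {V : (ι → ℝ) → ℝ} {C : ℝ} {r : ℕ → ℝ} {Z I : ℕ → Ω → ι → ℝ}

/-- A reinforced process with drift field `F`: given the past `ℱ n`, the actions `I (n + 1)`, with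
values in the unit cube, have mean `Z n + F (Z n)`, and the state `Z n` moves a step `r n` towards
them. -/
structure IsReinforcedProcess (P : Measure Ω) (ℱ : Filtration ℕ mΩ) (F : (ι → ℝ) → ι → ℝ)
    (r : ℕ → ℝ) (Z I : ℕ → Ω → ι → ℝ) : Prop where
  measurable_start : Measurable[ℱ 0] (Z 0)
  measurable_action : ∀ n, Measurable[ℱ (n + 1)] (I (n + 1))
  state_mem : ∀ n ω, Z n ω ∈ Set.Icc (0 : ι → ℝ) 1
  action_mem : ∀ n ω, I (n + 1) ω ∈ Set.Icc (0 : ι → ℝ) 1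
  dynamics : ∀ n ω, Z (n + 1) ω = (1 - r n) • Z n ω + r n • I (n + 1) ω
  condExp_action : ∀ n h, P[fun ω => I (n + 1) ω h | ℱ n] =ᵐ[P]
    fun ω => Z n ω h + F (Z n ω) h

/-- The deviation of the actions at time `n + 1` from their conditional mean. -/
def noise (F : (ι → ℝ) → ι → ℝ) (Z I : ℕ → Ω → ι → ℝ) (n : ℕ) (ω : Ω) : ι → ℝ :=
  I (n + 1) ω - (Z n ω + F (Z n ω))

lemma field_add_noise (n : ℕ) (ω : Ω) : F (Z n ω) + noise F Z I n ω = I (n + 1) ω - Z n ω := by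
  rw [noise]
  abel

namespace IsReinforcedProcess

lemma measurable_state (hS : IsReinforcedProcess P ℱ F r Z I) (n : ℕ) : Measurable[ℱ n] (Z n) := by
  induction n with
  | zero => exact hS.measurable_start
  | succ n ih =>
    rw [funext (hS.dynamics n)]
    exact ((ih.mono (ℱ.mono n.le_succ) le_rfl).const_smul (1 - r n)).add
      ((hS.measurable_action n).const_smul (r n))

lemma measurable_field [Finite ι] (hS : IsReinforcedProcess P ℱ F r Z I)
    (hF : ContinuousOn F (Set.Icc 0 1)) (n : ℕ) : Measurable[ℱ n] fun ω => F (Z n ω) := by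
  classical
  have hext : Measurable ((Set.Icc (0 : ι → ℝ) 1).piecewise F 0) :=
    hF.measurable_piecewise continuousOn_const measurableSet_Icc
  convert hext.comp (hS.measurable_state n) using 2 with ω
  exact (Set.piecewise_eq_of_mem _ _ _ (hS.state_mem n ω)).symm

lemma state_succ (hS : IsReinforcedProcess P ℱ F r Z I) (n : ℕ) (ω : Ω) :
    Z (n + 1) ω = Z n ω + r n • (F (Z n ω) + noise F Z I n ω) := by
  rw [field_add_noise, hS.dynamics]
  module

lemma norm_field_add_noise_le [Fintype ι] (hS : IsReinforcedProcess P ℱ F r Z I) (n : ℕ) (ω : Ω) :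
    ‖F (Z n ω) + noise F Z I n ω‖ ≤ 1 := by
  rw [field_add_noise]
  refine (pi_norm_le_iff_of_nonneg zero_le_one).2 fun h => abs_le.2 ?_
  have hZ₀ := (hS.state_mem n ω).1 h
  have hZ₁ := (hS.state_mem n ω).2 h
  have hI₀ := (hS.action_mem n ω).1 h
  have hI₁ := (hS.action_mem n ω).2 h
  simp only [Pi.zero_apply, Pi.one_apply, Pi.sub_apply] at *
  constructor <;> linarith

lemma exists_norm_field_le [Fintype ι] (hS : IsReinforcedProcess P ℱ F r Z I)
    (hF : ContinuousOn F (Set.Icc 0 1)) : ∃ M, ∀ n ω, ‖F (Z n ω)‖ ≤ M := by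
  obtain ⟨M, hM⟩ := isCompact_Icc.exists_bound_of_continuousOn hF
  exact ⟨M, fun n ω => hM _ (hS.state_mem n ω)⟩

lemma tendsto_average_action [Finite ι] (hS : IsReinforcedProcess P ℱ F r Z I)
    (hF : ContinuousOn F (Set.Icc 0 1)) {ω : Ω} {x : ι → ℝ} (hx : x ∈ Set.Icc 0 1) (hFx : F x = 0)
    (hZ : Tendsto (fun n => Z n ω) atTop (𝓝 x))
    (hnoise : Tendsto (fun n : ℕ => (n : ℝ)⁻¹ • ∑ k ∈ Finset.range n, noise F Z I k ω) atTop
      (𝓝 0)) :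
    Tendsto (fun n : ℕ => (n : ℝ)⁻¹ • ∑ k ∈ Finset.range n, I (k + 1) ω) atTop (𝓝 x) := by
  cases nonempty_fintype ι
  have hfield : Tendsto (fun n => F (Z n ω)) atTop (𝓝 0) := hFx ▸ (hF x hx).tendsto.comp
    (tendsto_nhdsWithin_iff.2 ⟨hZ, Eventually.of_forall fun n => hS.state_mem n ω⟩)
  have hmean := (hZ.add hfield).cesaro_smul.add hnoise
  simp only [add_zero, ← smul_add, ← Finset.sum_add_distrib] at hmean
  simpa only [noise, add_sub_cancel] using hmean

variable [IsFiniteMeasure P]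

lemma isMartingaleDifference_noise [Finite ι] (hS : IsReinforcedProcess P ℱ F r Z I)
    (hF : ContinuousOn F (Set.Icc 0 1)) (h : ι) :
    IsMartingaleDifference P ℱ fun n ω => noise F Z I n ω h := by
  set m : ℕ → Ω → ℝ := fun n ω => Z n ω h + F (Z n ω) h
  have hm_meas : ∀ n, Measurable[ℱ n] (m n) := fun n =>
    ((measurable_pi_apply h).comp (hS.measurable_state n)).add
      ((measurable_pi_apply h).comp (hS.measurable_field hF n))
  have hI_meas : ∀ n, Measurable[ℱ (n + 1)] fun ω => I (n + 1) ω h := fun n =>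
    (measurable_pi_apply h).comp (hS.measurable_action n)
  have hI_int : ∀ n, Integrable (fun ω => I (n + 1) ω h) P := fun n =>
    .of_mem_Icc 0 1 ((hI_meas n).mono (ℱ.le _) le_rfl).aemeasurable
      (Eventually.of_forall fun ω => ⟨(hS.action_mem n ω).1 h, (hS.action_mem n ω).2 h⟩)
  have hm_int : ∀ n, Integrable (m n) P := fun n =>
    integrable_condExp.congr (hS.condExp_action n h)
  refine ⟨fun n => ?_, fun n => (hI_int n).sub (hm_int n), fun n => ?_⟩
  · exact ((hI_meas n).sub ((hm_meas n).mono (ℱ.mono n.le_succ) le_rfl)).stronglyMeasurable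
  · filter_upwards [condExp_sub (hI_int n) (hm_int n) (ℱ n), hS.condExp_action n h] with ω hsub hact
    refine hsub.trans ?_
    rw [Pi.sub_apply, hact, condExp_of_stronglyMeasurable (ℱ.le n) (hm_meas n).stronglyMeasurable
      (hm_int n), sub_self, Pi.zero_apply]

lemma ae_exists_tendsto_sum_mul_noise [Fintype ι] (hS : IsReinforcedProcess P ℱ F r Z I)
    (hF : ContinuousOn F (Set.Icc 0 1)) {c : ℕ → Ω → ι → ℝ} {b : ℕ → ℝ}
    (hc : ∀ n, Measurable[ℱ n] (c n)) (hcb : ∀ n ω, ‖c n ω‖ ≤ b n)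
    (hb : Summable fun n => b n ^ 2) :
    ∀ᵐ ω ∂P, ∃ l, Tendsto (fun n => ∑ k ∈ Finset.range n, c k ω * noise F Z I k ω) atTop (𝓝 l) := by
  obtain ⟨M, hM⟩ := hS.exists_norm_field_le hF
  have hbound : ∀ n ω h, |noise F Z I n ω h| ≤ 1 + M := fun n ω h =>
    calc |noise F Z I n ω h| ≤ ‖noise F Z I n ω‖ := norm_le_pi_norm (noise F Z I n ω) h
      _ = ‖F (Z n ω) + noise F Z I n ω - F (Z n ω)‖ := by rw [add_sub_cancel_left]
      _ ≤ 1 + M := norm_sub_le_of_le (hS.norm_field_add_noise_le n ω) (hM n ω)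
  have hcoord : ∀ h, ∀ᵐ ω ∂P, ∃ l,
      Tendsto (fun n => ∑ k ∈ Finset.range n, c k ω h * noise F Z I k ω h) atTop (𝓝 l) := fun h =>
    (hS.isMartingaleDifference_noise hF h).ae_exists_tendsto_sum_range_mul
      (fun n ω => hbound n ω h)
      (fun n => ((measurable_pi_apply h).comp (hc n)).stronglyMeasurable)
      (fun n ω => (norm_le_pi_norm (c n ω) h).trans (hcb n ω)) hb
  filter_upwards [ae_all_iff.2 hcoord] with ω hω
  choose l hl using hω
  refine ⟨l, tendsto_pi_nhds.2 fun h => ?_⟩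
  simpa only [Finset.sum_apply, Pi.mul_apply] using hl h

lemma ae_exists_tendsto_sum_smul_noise [Finite ι] (hS : IsReinforcedProcess P ℱ F r Z I)
    (hF : ContinuousOn F (Set.Icc 0 1)) {c : ℕ → ℝ} (hc : Summable fun n => c n ^ 2) :
    ∀ᵐ ω ∂P, ∃ l, Tendsto (fun n => ∑ k ∈ Finset.range n, c k • noise F Z I k ω) atTop (𝓝 l) := by
  cases nonempty_fintype ι
  exact hS.ae_exists_tendsto_sum_mul_noise hF (c := fun n _ _ => c n) (b := fun n => |c n|)
    (fun _ => measurable_const) (fun n _ => pi_norm_const_le (c n))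
    (by simpa only [sq_abs] using hc)

lemma ae_exists_tendsto_sum_mul_dotProduct_noise [Fintype ι] (hS : IsReinforcedProcess P ℱ F r Z I)
    (hF : ContinuousOn F (Set.Icc 0 1)) (hr : Summable fun n => r n ^ 2) :
    ∀ᵐ ω ∂P, ∃ l, Tendsto
      (fun n => ∑ k ∈ Finset.range n, r k * (F (Z k ω) ⬝ᵥ noise F Z I k ω)) atTop (𝓝 l) := by
  obtain ⟨M, hM⟩ := hS.exists_norm_field_le hF
  filter_upwards [hS.ae_exists_tendsto_sum_mul_noise hF (c := fun n ω => r n • F (Z n ω))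
    (b := fun n => |r n| * M) (fun n => (hS.measurable_field hF n).const_smul (r n))
    (fun n ω => by
      rw [norm_smul, Real.norm_eq_abs]
      exact mul_le_mul_of_nonneg_left (hM n ω) (abs_nonneg _))
    (by simpa only [mul_pow, sq_abs] using hr.mul_right (M ^ 2))] with ω ⟨l, hl⟩
  refine ⟨∑ h, l h, (tendsto_finsetSum _ fun h _ => tendsto_pi_nhds.1 hl h).congr fun n => ?_⟩
  simp only [Finset.sum_apply, Pi.mul_apply, Pi.smul_apply, smul_eq_mul, dotProduct,
    Finset.mul_sum, mul_assoc]
  exact Finset.sum_comm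

lemma ae_tendsto_average_noise [Finite ι] (hS : IsReinforcedProcess P ℱ F r Z I)
    (hF : ContinuousOn F (Set.Icc 0 1)) :
    ∀ᵐ ω ∂P, Tendsto (fun n : ℕ => (n : ℝ)⁻¹ • ∑ k ∈ Finset.range n, noise F Z I k ω) atTop
      (𝓝 0) := by
  cases nonempty_fintype ι
  have hsq : Summable fun n : ℕ => (((n : ℝ) + 1)⁻¹) ^ 2 := by
    have := (summable_nat_add_iff 1).2 (Real.summable_nat_pow_inv.2 one_lt_two)
    simpa only [inv_pow, Nat.cast_add_one] using this
  filter_upwards [hS.ae_exists_tendsto_sum_smul_noise hF hsq] with ω ⟨l, hl⟩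
  exact tendsto_average_zero_of_tendsto_sum_inv_smul hl

theorem ae_exists_tendsto [Fintype ι] (hS : IsReinforcedProcess P ℱ F r Z I) (hr : IsRobbinsMonro r)
    {L : NNReal} (hF : LipschitzOnWith L F (Set.Icc 0 1))
    (hV : IsLowerGradientOn V F C (Set.Icc 0 1)) (hfin : {x ∈ Set.Icc 0 1 | F x = 0}.Finite) :
    ∀ᵐ ω ∂P, ∃ x ∈ {x ∈ Set.Icc 0 1 | F x = 0}, Tendsto (fun n => Z n ω) atTop (𝓝 x) ∧
      Tendsto (fun n : ℕ => (n : ℝ)⁻¹ • ∑ k ∈ Finset.range n, I (k + 1) ω) atTop (𝓝 x) := by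
  filter_upwards [hS.ae_exists_tendsto_sum_smul_noise hF.continuousOn hr.summable_sq,
    hS.ae_exists_tendsto_sum_mul_dotProduct_noise hF.continuousOn hr.summable_sq,
    hS.ae_tendsto_average_noise hF.continuousOn] with ω ⟨_, hsum⟩ ⟨_, hdot⟩ havg
  obtain ⟨x, hx, hFx, hZ⟩ := hV.exists_tendsto_zero hr isCompact_Icc hF hfin
    (fun n => hS.state_mem n ω) (fun n => hS.state_succ n ω)
    (fun n => hS.norm_field_add_noise_le n ω) hsum hdot
  exact ⟨x, ⟨hx, hFx⟩, hZ, hS.tendsto_average_action hF.continuousOn hx hFx hZ havg⟩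

end IsReinforcedProcess

end ReinforcedProcess

section MeanField

open scoped NNReal

lemma mul_sub_sub_le_integral {g : ℝ → ℝ} {K : ℝ≥0} {x y : ℝ}
    (hg : LipschitzOnWith K g (Set.uIcc x y)) :
    g x * (y - x) - K * (y - x) ^ 2 ≤ ∫ t in x..y, g t := by
  have hbound : ∀ t ∈ Set.uIoc x y, ‖g t - g x‖ ≤ K * |y - x| := fun t ht => by
    have ht' := Set.uIoc_subset_uIcc ht
    refine (hg.norm_sub_le ht' Set.left_mem_uIcc).trans ?_
    gcongr
    exact Set.abs_sub_left_of_mem_uIcc ht'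
  have herror := intervalIntegral.norm_integral_le_of_norm_le_const hbound
  rw [intervalIntegral.integral_sub hg.continuousOn.intervalIntegrable intervalIntegrable_const,
    intervalIntegral.integral_const, smul_eq_mul, Real.norm_eq_abs, mul_assoc,
    abs_mul_abs_self] at herror
  linarith [neg_abs_le ((∫ t in x..y, g t) - (y - x) * g x)]

lemma apply_mem_Icc {ι : Type*} {z : ι → ℝ} (hz : z ∈ Set.Icc 0 1) (i : ι) :
    z i ∈ Set.Icc (0 : ℝ) 1 :=
  ⟨hz.1 i, hz.2 i⟩

variable {ι : Type*} [Fintype ι] {a : ℝ} {g : ℝ → ℝ} {K : ℝ≥0}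

/-- The average of the coordinates of a vector, equal to `0` if there are no coordinates. -/
noncomputable def mean (z : ι → ℝ) : ℝ := 1 / (Fintype.card ι : ℝ) * ∑ i, z i

/-- The field in which every coordinate `z h` evolves by `g` and is coupled with strength `a` to
the average of all coordinates. -/
noncomputable def meanFieldDrift (a : ℝ) (g : ℝ → ℝ) (z : ι → ℝ) : ι → ℝ :=
  fun h => a * mean z + g (z h)

/-- A function whose gradient on the unit cube is `meanFieldDrift a g` when `g` is continuous on
the unit interval. -/
noncomputable def meanFieldPotential (a : ℝ) (g : ℝ → ℝ) (z : ι → ℝ) : ℝ :=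
  a * Fintype.card ι / 2 * mean z ^ 2 + ∑ i, ∫ t in 0..z i, g t

lemma card_mul_mean (z : ι → ℝ) : Fintype.card ι * mean z = ∑ i, z i := by
  cases isEmpty_or_nonempty ι
  · simp
  · rw [mean, ← mul_assoc, mul_one_div_cancel (by simp), one_mul]

lemma mean_sub (z w : ι → ℝ) : mean (z - w) = mean z - mean w := by
  simp only [mean, Pi.sub_apply, Finset.sum_sub_distrib, mul_sub]

lemma mean_const [Nonempty ι] (x : ℝ) : mean (fun _ : ι => x) = x := by
  rw [mean, Finset.sum_const, Finset.card_univ, nsmul_eq_mul, ← mul_assoc,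
    one_div_mul_cancel (by simp), one_mul]

lemma abs_mean_le_norm (z : ι → ℝ) : |mean z| ≤ ‖z‖ := by
  cases isEmpty_or_nonempty ι
  · simp [mean]
  · rw [mean, one_div, abs_mul, abs_of_nonneg (by positivity),
      inv_mul_le_iff₀ (Nat.cast_pos.2 Fintype.card_pos)]
    calc |∑ i, z i| ≤ ∑ i, |z i| := Finset.abs_sum_le_sum_abs _ _
      _ ≤ Fintype.card ι • ‖z‖ := Finset.sum_le_card_nsmul _ _ _ fun i _ => norm_le_pi_norm z i
      _ = Fintype.card ι * ‖z‖ := nsmul_eq_mul _ _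

lemma lipschitzOnWith_meanFieldDrift (hg : LipschitzOnWith K g (Set.Icc 0 1)) :
    LipschitzOnWith (‖a‖₊ + K) (meanFieldDrift a g) (Set.Icc (0 : ι → ℝ) 1) := by
  refine LipschitzOnWith.of_dist_le_mul fun z hz w hw => ?_
  refine (dist_pi_le_iff (by positivity)).2 fun h => ?_
  have hself := hg.norm_sub_le (apply_mem_Icc hz h) (apply_mem_Icc hw h)
  calc dist (meanFieldDrift a g z h) (meanFieldDrift a g w h)
      = ‖a * mean (z - w) + (g (z h) - g (w h))‖ := by
        rw [dist_eq_norm, meanFieldDrift, meanFieldDrift, mean_sub]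
        ring_nf
    _ ≤ ‖a‖ * ‖z - w‖ + K * ‖z - w‖ := by
        refine norm_add_le_of_le ?_ (hself.trans ?_)
        · rw [norm_mul]
          gcongr
          exact abs_mean_le_norm _
        · gcongr
          exact norm_le_pi_norm (z - w) h
    _ = (‖a‖₊ + K : ℝ≥0) * dist z w := by
        rw [← add_mul, dist_eq_norm]
        rfl

lemma sum_integral_sub_sum_integral (hg : ContinuousOn g (Set.Icc 0 1)) {z w : ι → ℝ}
    (hz : z ∈ Set.Icc 0 1) (hw : w ∈ Set.Icc 0 1) :
    ∑ i, (∫ t in 0..w i, g t) - ∑ i, ∫ t in 0..z i, g t = ∑ i, ∫ t in z i..w i, g t := by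
  have hint : ∀ x ∈ Set.Icc (0 : ℝ) 1, IntervalIntegrable g volume 0 x := fun x hx =>
    (hg.mono (Set.uIcc_subset_Icc (by simp) hx)).intervalIntegrable
  rw [← Finset.sum_sub_distrib]
  exact Finset.sum_congr rfl fun i _ => intervalIntegral.integral_interval_sub_left
    (hint _ (apply_mem_Icc hw i)) (hint _ (apply_mem_Icc hz i))

lemma isLowerGradientOn_meanFieldPotential (hg : LipschitzOnWith K g (Set.Icc 0 1)) :
    IsLowerGradientOn (meanFieldPotential a g) (meanFieldDrift a g)
      (Fintype.card ι * (|a| / 2 + K)) (Set.Icc (0 : ι → ℝ) 1) := by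
  intro z hz w hw
  set v := w - z with hv
  have hself : ∑ i, g (z i) * v i - Fintype.card ι * (K * ‖v‖ ^ 2)
      ≤ ∑ i, ∫ t in z i..w i, g t := by
    rw [← nsmul_eq_mul, ← Finset.card_univ, ← Finset.sum_const, ← Finset.sum_sub_distrib]
    refine Finset.sum_le_sum fun i _ => le_trans ?_ (mul_sub_sub_le_integral (hg.mono
      (Set.uIcc_subset_Icc (apply_mem_Icc hz i) (apply_mem_Icc hw i))))
    have hvi : v i ^ 2 ≤ ‖v‖ ^ 2 := sq_le_sq.2 ((norm_le_pi_norm v i).trans (le_abs_self _))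
    exact sub_le_sub_left (mul_le_mul_of_nonneg_left hvi K.coe_nonneg) _
  have hmean : |a * mean v ^ 2| ≤ |a| * ‖v‖ ^ 2 := by
    rw [abs_mul, abs_sq, ← sq_abs (mean v)]
    gcongr
    exact abs_mean_le_norm v
  have hcoupling : mean w = mean z + mean v := by rw [hv, mean_sub, add_sub_cancel]
  calc meanFieldDrift a g z ⬝ᵥ v - Fintype.card ι * (|a| / 2 + K) * ‖v‖ ^ 2
      = a * mean z * (Fintype.card ι * mean v) - Fintype.card ι / 2 * (|a| * ‖v‖ ^ 2)
        + (∑ i, g (z i) * v i - Fintype.card ι * (K * ‖v‖ ^ 2)) := by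
        simp only [dotProduct, meanFieldDrift, add_mul, Finset.sum_add_distrib, ← Finset.mul_sum,
          card_mul_mean]
        ring
    _ ≤ a * mean z * (Fintype.card ι * mean v) + Fintype.card ι / 2 * (a * mean v ^ 2)
        + ∑ i, ∫ t in z i..w i, g t := by
        have := mul_le_mul_of_nonneg_left (neg_le.1 ((neg_le_abs _).trans hmean))
          (by positivity : 0 ≤ (Fintype.card ι : ℝ) / 2)
        linarith
    _ = meanFieldPotential a g w - meanFieldPotential a g z := by
        rw [← sum_integral_sub_sum_integral hg.continuousOn hz hw, meanFieldPotential,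
          meanFieldPotential, hcoupling]
        ring

lemma exists_meanFieldDrift_const_eq_zero [Nonempty ι] (hg : ContinuousOn g (Set.Icc 0 1))
    (hg₀ : 0 ≤ g 0) (hg₁ : a + g 1 ≤ 0) :
    ∃ x ∈ Set.Icc (0 : ℝ) 1, meanFieldDrift a g (fun _ : ι => x) = 0 := by
  obtain ⟨x, hx, hzero⟩ : (0 : ℝ) ∈ (fun x => a * x + g x) '' Set.Icc 0 1 :=
    intermediate_value_Icc' zero_le_one (by fun_prop) ⟨by simpa, by simpa⟩
  refine ⟨x, hx, funext fun h => ?_⟩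
  rw [meanFieldDrift, mean_const]
  exact hzero

end MeanField

section Drift

open scoped NNReal

variable {N : ℕ} {α β q : ℝ} {f : ℝ → ℝ} {K : ℝ≥0}

/-- The part of the drift of a coordinate that depends on this coordinate only. -/
def selfDrift (α β q : ℝ) (f : ℝ → ℝ) (x : ℝ) : ℝ := β * q + (1 - α - β) * f x - x

lemma drift_eq_meanFieldDrift : drift N α β q f = meanFieldDrift α (selfDrift α β q f) := by
  ext z h
  simp only [drift, meanFieldDrift, mean, selfDrift, Fintype.card_fin]
  ring

lemma lipschitzOnWith_selfDrift {s : Set ℝ} (hf : LipschitzOnWith K f s) :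
    LipschitzOnWith (‖1 - α - β‖₊ * K + 1) (selfDrift α β q f) s := by
  refine LipschitzOnWith.of_dist_le_mul fun x hx y hy => ?_
  calc dist (selfDrift α β q f x) (selfDrift α β q f y)
      = ‖(1 - α - β) * (f x - f y) + (y - x)‖ := by
        rw [dist_eq_norm, selfDrift, selfDrift]
        ring_nf
    _ ≤ ‖1 - α - β‖ * (K * ‖x - y‖) + ‖x - y‖ := by
        refine norm_add_le_of_le ?_ (norm_sub_rev y x).le
        rw [norm_mul]
        gcongr
        exact hf.norm_sub_le hx hy
    _ = (‖1 - α - β‖₊ * K + 1 : ℝ≥0) * dist x y := by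
        push_cast
        rw [dist_eq_norm]
        ring

lemma zeroSet_eq : zeroSet N α β q f = {z ∈ Set.Icc 0 1 | drift N α β q f z = 0} := by
  ext z
  simp only [zeroSet, Set.mem_ofPred_eq, Set.mem_Icc, Pi.le_def, Pi.zero_apply, Pi.one_apply,
    forall_and]

lemma exists_diagonal_mem_zeroSet (hN : 1 ≤ N) (hβ : 0 ≤ β) (hαβ : α + β ≤ 1)
    (hq : q ∈ Set.Icc (0 : ℝ) 1) (hf_maps : Set.MapsTo f (Set.Icc 0 1) (Set.Icc 0 1))
    (hf : ContinuousOn f (Set.Icc 0 1)) :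
    ∃ z ∈ Set.Icc (0 : ℝ) 1, (fun _ => z) ∈ zeroSet N α β q f := by
  have : Nonempty (Fin N) := ⟨⟨0, hN⟩⟩
  have hself : ContinuousOn (selfDrift α β q f) (Set.Icc 0 1) := by
    unfold selfDrift
    fun_prop
  have hweight : 0 ≤ 1 - α - β := by linarith
  have hself₀ : 0 ≤ selfDrift α β q f 0 := by
    have hf₀ := (hf_maps (Set.left_mem_Icc.2 zero_le_one)).1
    rw [selfDrift, sub_zero]
    exact add_nonneg (mul_nonneg hβ hq.1) (mul_nonneg hweight hf₀)
  have hself₁ : α + selfDrift α β q f 1 ≤ 0 := by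
    have hf₁ := (hf_maps (Set.right_mem_Icc.2 zero_le_one)).2
    rw [selfDrift]
    linarith [mul_le_of_le_one_right hβ hq.2, mul_le_of_le_one_right hweight hf₁]
  obtain ⟨z, hz, hzero⟩ := exists_meanFieldDrift_const_eq_zero (ι := Fin N) hself hself₀ hself₁
  exact ⟨z, hz, fun _ => hz, drift_eq_meanFieldDrift ▸ hzero⟩

end Drift

section System

variable {Ω : Type*} {N : ℕ} {Z I : ℕ → Ω → Fin N → ℝ}

lemma empiricalMean_eq (I : ℕ → Ω → Fin N → ℝ) (n : ℕ) (ω : Ω) :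
    empiricalMean I n ω = (n : ℝ)⁻¹ • ∑ k ∈ Finset.range n, I (k + 1) ω := by
  rw [empiricalMean, one_div, Finset.range_eq_Ico, Finset.sum_Ico_add' (fun k => I k ω) 0 n 1]
  rfl

lemma past_mono : Monotone (past Z I) :=
  fun _ _ hmn => sup_le_sup_left (biSup_mono fun _ hk => Finset.Icc_subset_Icc_right hmn hk) _

lemma measurable_start_past : Measurable[past Z I 0] (Z 0) :=
  @measurable_pi_lambda _ _ _ (past Z I 0) _ _ fun h => Measurable.of_comap_le <|
    le_sup_of_le_left <| le_iSup (fun h => MeasurableSpace.comap (fun ω => Z 0 ω h) (borel ℝ)) h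

lemma measurable_action_past (n : ℕ) : Measurable[past Z I (n + 1)] (I (n + 1)) :=
  @measurable_pi_lambda _ _ _ (past Z I (n + 1)) _ _ fun h => Measurable.of_comap_le <|
    le_sup_of_le_right <| le_iSup₂_of_le (n + 1) (by simp) <|
      le_iSup (fun h => MeasurableSpace.comap (fun ω => I (n + 1) ω h) (borel ℝ)) h

variable [mΩ : MeasurableSpace Ω] {P : Measure Ω} {α β q : ℝ} {f : ℝ → ℝ} {r : ℕ → ℝ}

namespace IsSystem

lemma past_le (hS : IsSystem P N α β q f r Z I) (n : ℕ) : past Z I n ≤ mΩ := by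
  refine sup_le (iSup_le fun h => (hS.measurable_start h).comap_le)
    (iSup₂_le fun k hk => iSup_le fun h => ?_)
  obtain ⟨j, rfl⟩ := Nat.exists_eq_add_of_le' (Finset.mem_Icc.1 hk).1
  exact (hS.measurable_action j h).comap_le

/-- The filtration of the past information `past Z I n`. -/
def pastFiltration (hS : IsSystem P N α β q f r Z I) : Filtration ℕ mΩ where
  seq := past Z I
  mono' := past_mono
  le' := hS.past_le

lemma isReinforcedProcess (hS : IsSystem P N α β q f r Z I) :
    IsReinforcedProcess P hS.pastFiltration (drift N α β q f) r Z I where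
  measurable_start := measurable_start_past
  measurable_action := measurable_action_past
  state_mem n ω := ⟨fun h => (hS.state_mem n ω h).1, fun h => (hS.state_mem n ω h).2⟩
  action_mem n ω := by
    refine ⟨fun h => ?_, fun h => ?_⟩ <;> rcases hS.action_mem n ω h with e | e <;> simp [e]
  dynamics n ω := funext fun h => hS.dynamics n ω h
  condExp_action n h := by
    have hind : (fun ω => I (n + 1) ω h) = {ω | I (n + 1) ω h = 1}.indicator fun _ => 1 := by
      ext ω
      rcases hS.action_mem n ω h with e | e <;> simp [e]
    rw [hind]
    filter_upwards [hS.cond_prob n h] with ω hω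
    refine hω.trans ?_
    rw [drift, add_sub_cancel]

end IsSystem

end System

end ReinforcedSystem

open ReinforcedSystem in
theorem theorem2p1_general (N : ℕ) (hN : 1 ≤ N) (α β q : ℝ) (hβ : 0 ≤ β) (hαβ : α + β ≤ 1)
    (hq : q ∈ Set.Icc (0 : ℝ) 1) (f : ℝ → ℝ)
    (hf_maps : Set.MapsTo f (Set.Icc 0 1) (Set.Icc 0 1)) {K : NNReal}
    (hf_lip : LipschitzOnWith K f (Set.Icc 0 1)) :
    (∃ z ∈ Set.Icc (0 : ℝ) 1, (fun _ => z) ∈ zeroSet N α β q f) ∧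
    ((zeroSet N α β q f).Finite →
      ∀ {Ω : Type*} {mΩ : MeasurableSpace Ω} (P : Measure Ω) [IsProbabilityMeasure P]
        (ℱ : Filtration ℕ mΩ) (r : ℕ → ℝ) (Z I : ℕ → Ω → Fin N → ℝ),
        IsRobbinsMonro r → IsReinforcedProcess P ℱ (drift N α β q f) r Z I →
        ∃ Zinf : Ω → Fin N → ℝ, Measurable Zinf ∧ (∀ ω, Zinf ω ∈ zeroSet N α β q f) ∧
          (∀ᵐ ω ∂P, Tendsto (fun n => Z n ω) atTop (𝓝 (Zinf ω))) ∧
          (∀ᵐ ω ∂P, Tendsto (fun n => empiricalMean I n ω) atTop (𝓝 (Zinf ω)))) := by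
  refine ⟨exists_diagonal_mem_zeroSet hN hβ hαβ hq hf_maps hf_lip.continuousOn, ?_⟩
  intro hfin Ω mΩ P _ ℱ r Z I hr hS
  have hself := lipschitzOnWith_selfDrift (α := α) (β := β) (q := q) hf_lip
  have hconv : ∀ᵐ ω ∂P, ∃ x ∈ zeroSet N α β q f, Tendsto (fun n => Z n ω) atTop (𝓝 x) ∧
      Tendsto (fun n => empiricalMean I n ω) atTop (𝓝 x) := by
    simp only [empiricalMean_eq]
    rw [zeroSet_eq, drift_eq_meanFieldDrift] at *
    exact hS.ae_exists_tendsto hr (lipschitzOnWith_meanFieldDrift hself)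
      (isLowerGradientOn_meanFieldPotential hself) hfin
  obtain ⟨Zinf, hmeas, hmem, hlim⟩ := exists_measurable_limit_mem hfin.measurableSet
    (fun n => ((hS.measurable_state n).mono (ℱ.le n) le_rfl).aemeasurable)
    (hconv.mono fun ω ⟨x, hx, hZ, _⟩ => ⟨x, hx, hZ⟩)
  refine ⟨Zinf, hmeas, hmem, hlim, ?_⟩
  filter_upwards [hconv, hlim] with ω ⟨x, _, hZ, hI⟩ hω
  rwa [tendsto_nhds_unique hω hZ]

theorem theorem2p1 (N : ℕ) (hN : 1 ≤ N) (α β q : ℝ)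
    (hα : α ∈ Set.Ico (0 : ℝ) 1) (hβ : β ∈ Set.Ico (0 : ℝ) 1)
    (hαβ : α + β ∈ Set.Ioo (0 : ℝ) 1) (hq : q ∈ Set.Ioc (0 : ℝ) 1)
    (f : ℝ → ℝ) (hf_mono : StrictMonoOn f (Set.Icc 0 1))
    (hf_maps : Set.MapsTo f (Set.Icc 0 1) (Set.Icc 0 1))
    (hf_diff : ContDiffOn ℝ 1 f (Set.Icc 0 1)) :
    (∃ z ∈ Set.Icc (0 : ℝ) 1, (fun _ => z) ∈ ReinforcedSystem.zeroSet N α β q f) ∧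
    ((ReinforcedSystem.zeroSet N α β q f).Finite → ReinforcedSystem.HasPrimitive f →
      ∀ {Ω : Type*} [MeasurableSpace Ω] (P : Measure Ω) [IsProbabilityMeasure P]
        (r : ℕ → ℝ) (Z I : ℕ → Ω → Fin N → ℝ),
        Tendsto (fun n : ℕ => (n : ℝ) * r n) atTop (𝓝 1) →
        ReinforcedSystem.IsSystem P N α β q f r Z I →
        ∃ Zinf : Ω → Fin N → ℝ, Measurable Zinf ∧
          (∀ ω, Zinf ω ∈ ReinforcedSystem.zeroSet N α β q f) ∧
          (∀ᵐ ω ∂P, Tendsto (fun n => Z n ω) atTop (𝓝 (Zinf ω))) ∧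
          (∀ᵐ ω ∂P, Tendsto (fun n => ReinforcedSystem.empiricalMean I n ω) atTop
            (𝓝 (Zinf ω)))) := by
  obtain ⟨K, hf_lip⟩ :=
    hf_diff.exists_lipschitzOnWith one_ne_zero (convex_Icc 0 1) isCompact_Icc
  obtain ⟨hdiag, hconv⟩ := theorem2p1_general N hN α β q hβ.1 hαβ.2.le ⟨hq.1.le, hq.2⟩ f hf_maps
    hf_lip
  exact ⟨hdiag, fun hfin _ _ _ P _ r Z I hr hS =>
    hconv hfin P _ r Z I (.of_tendsto_mul one_pos hr) hS.isReinforcedProcess⟩
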